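/- Let $G$ be a real Lie group with Lie algebra $\mathfrak g=T_eG$, supplied with a one-parameter multiplicative group $(\delta_s)_{s>0}$ of smooth automorphisms, and put $\mathfrak g_k=\{v\in\mathfrak g: d\delta_s(v)=s^kv \text{ for all } s>0\}$. Assume that $G$ is a Carnot group, i.e. that $\mathfrak g_1$ generates the Lie algebra $\mathfrak g$. Let a left-invariant (sub-)Riemannian metric on $G$ be given by the left-invariant distribution $D$ with $D(e)=\mathfrak g_1$ and a left-invariant scalar product $\langle\cdot,\cdot\rangle$ on $D$, and let $D^\perp$ be the left-invariant distribution with $D^\perp(e)=\bigoplus_{k\ge 2}\mathfrak g_k$ (which is $0$ if $\mathfrak g$ is commutative). (a) $D^\perp$ is a rigging of $D$, i.e. $TG=D\oplus D^\perp$. It satisfies the following condition: for every left-invariant $1$-form $\omega$ vanishing on $D^\perp$ and all left-invariant vector fields $W,X$ one has $\omega([W,X])=0$. Moreover $D^\perp$ depends only on $D$: it is the only left-invariant rigging of $D$ satisfying this condition. (b) There is a left-invariant Riemannian metric $(\cdot,\cdot)$ on $G$ with $(\cdot,\cdot)|_D=\langle\cdot,\cdot\rangle$ and $(D,D^\perp)=0$,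 and for every such metric all Solov'ev curvatures of $D$ are zero: the curvature tensor $K$ vanishes, and so do all sectional, Ricci and scalar curvatures. Here the Solov'ev curvatures are defined as follows. Let $\nabla$ be the Levi-Civita connection of $(\cdot,\cdot)$, let $H,V$ be the projections of $TG=D\oplus D^\perp$ onto $D$ and $D^\perp$, let $\overline\nabla_XY=H\nabla_XHY+V\nabla_XVY$, and let $T$ be the torsion of $\overline\nabla$. Define a connection $C$ by $$(C_XY,Z)=(\overline\nabla_XHY,HZ)-\tfrac12\,(X,T(HY,HZ))$$ for all vector fields $X,Y,Z$ (so $C_XVY=0$), and put $K(X,Y)Z=\hat K(X,Y)HZ$, where $\hat K(X,Y)=C_XC_Y-C_YC_X-C_{[X,Y]}$ is the curvature tensor of $C$. For linearly independent $u,v\in D(p)$ the sectional curvature is $K_{uv}=(K(u,v)v,u)/(\|u\|^2\|v\|^2-(u,v)^2)$. For an orthonormal basis $(e_i)$ of $D(p)$ and $0\ne w\in D(p)$ the Ricci curvature in the direction of $w$ is $k_w=\sum_i (K(e_i,w)w,e_i)/\|w\|^2$, and the scalar curvature at $p$ is $s=\sum_j k_{e_j}$. -/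

import Mathlib

open scoped Manifold ContDiff
open VectorField

/-- Over `ℝ`, the smoothness needed by Mathlib for the Lie algebra of a Lie group is at most `∞`. -/
instance instLEInftyMinSmoothnessReal : ENat.LEInfty (minSmoothness ℝ 3) :=
  ⟨by
    rw [minSmoothness_of_isRCLikeNormedField]
    exact ENat.LEInfty.out⟩

/-- A scalar product on a real vector space: a symmetric positive definite bilinear form. -/
structure IsScalarProduct {W : Type*} [AddCommGroup W] [Module ℝ W]
    (B : LinearMap.BilinForm ℝ W) : Prop where
  symm : ∀ u v, B u v = B v u
  pos : ∀ v, v ≠ 0 → 0 < B v v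

open Classical in
/-- The projection of `W` onto `P` along a complement `Q` (and `0` if `Q` is not a complement). -/
noncomputable def projectionAlong {W : Type*} [AddCommGroup W] [Module ℝ W]
    (P Q : Submodule ℝ W) : W →ₗ[ℝ] W :=
  if h : IsCompl P Q then P.projection Q h else 0

/-! ### Curvatures of a rigged metrized distribution on a Riemannian manifold -/

namespace Solovev

noncomputable section

section General

variable {n : ℕ} {M : Type*} [TopologicalSpace M] [ChartedSpace (EuclideanSpace ℝ (Fin n)) M]
  [IsManifold (𝓡 n) ∞ M]

/-- A (not necessarily smooth) vector field on `M`. -/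
abbrev Field (n : ℕ) (M : Type*) [TopologicalSpace M]
    [ChartedSpace (EuclideanSpace ℝ (Fin n)) M] : Type _ :=
  (p : M) → TangentSpace (𝓡 n) p

/-- A field of bilinear forms on the tangent spaces of `M`. -/
abbrev Metric (n : ℕ) (M : Type*) [TopologicalSpace M]
    [ChartedSpace (EuclideanSpace ℝ (Fin n)) M] : Type _ :=
  (p : M) → LinearMap.BilinForm ℝ (TangentSpace (𝓡 n) p)

/-- A field of subspaces of the tangent spaces of `M`. -/
abbrev Distribution (n : ℕ) (M : Type*) [TopologicalSpace M]
    [ChartedSpace (EuclideanSpace ℝ (Fin n)) M] : Type _ :=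
  (p : M) → Submodule ℝ (TangentSpace (𝓡 n) p)

/-- The vector field `X` is smooth (of class `C^∞`). -/
def IsSmooth (X : Field n M) : Prop :=
  ContMDiff (𝓡 n) (𝓡 n).tangent ∞ (fun p => (⟨p, X p⟩ : TangentBundle (𝓡 n) M))

/-- The derivative `X f` of a function along a vector field. -/
def dirDeriv (X : Field n M) (f : M → ℝ) (p : M) : ℝ :=
  mfderiv (𝓡 n) 𝓘(ℝ, ℝ) f p (X p)

/-- The function `(X, Y)`. -/
def pair (g : Metric n M) (X Y : Field n M) (p : M) : ℝ := g p (X p) (Y p)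

open Classical in
/-- The vector `w ∈ T_p M` with `(w, Z(p)) = Φ(Z)` for all smooth vector fields `Z`. It exists and
is unique when `g p` is nondegenerate, every vector at `p` is the value of a smooth field, and
`Φ(Z)` depends linearly on `Z(p)` only. -/
def representative (g : Metric n M) (p : M) (Φ : Field n M → ℝ) : TangentSpace (𝓡 n) p :=
  if h : ∃ w : TangentSpace (𝓡 n) p, ∀ Z : Field n M, IsSmooth Z → g p w (Z p) = Φ Z
  then h.choose else 0

/-- The Levi-Civita connection `∇_X Y` of `g`, given by Koszul's formula. -/
def leviCivita (g : Metric n M) (X Y : Field n M) : Field n M := fun p =>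
  representative g p fun Z =>
    (1 / 2) * (dirDeriv X (pair g Y Z) p + dirDeriv Y (pair g Z X) p - dirDeriv Z (pair g X Y) p
      + pair g (mlieBracket (𝓡 n) X Y) Z p - pair g (mlieBracket (𝓡 n) Y Z) X p
      + pair g (mlieBracket (𝓡 n) Z X) Y p)

/-- The component `HX` of `X` in `D`, for the splitting `TM = D ⊕ D'`. -/
def hor (D D' : Distribution n M) (X : Field n M) : Field n M := fun p =>
  projectionAlong (D p) (D' p) (X p)

/-- The component `VX` of `X` in the rigging `D'`, for the splitting `TM = D ⊕ D'`. -/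
def ver (D D' : Distribution n M) (X : Field n M) : Field n M := fun p =>
  projectionAlong (D' p) (D p) (X p)

/-- The induced connection `∇̄_X Y = H ∇_X HY + V ∇_X VY`. -/
def inducedConnection (g : Metric n M) (D D' : Distribution n M) (X Y : Field n M) : Field n M :=
  hor D D' (leviCivita g X (hor D D' Y)) + ver D D' (leviCivita g X (ver D D' Y))

/-- The torsion `T(X,Y) = ∇̄_X Y - ∇̄_Y X - [X,Y]` of the induced connection. -/
def inducedTorsion (g : Metric n M) (D D' : Distribution n M) (X Y : Field n M) : Field n M :=
  inducedConnection g D D' X Y - inducedConnection g D D' Y X - mlieBracket (𝓡 n) X Y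

/-- Solov'ev's connection `C`: `(C_X Y, Z) = (∇̄_X HY, HZ) - (1/2) (X, T(HY, HZ))`, so that
`C_X VY = 0`. -/
def connection (g : Metric n M) (D D' : Distribution n M) (X Y : Field n M) : Field n M := fun p =>
  representative g p fun Z =>
    pair g (inducedConnection g D D' X (hor D D' Y)) (hor D D' Z) p
      - (1 / 2) * pair g X (inducedTorsion g D D' (hor D D' Y) (hor D D' Z)) p

/-- The curvature of the connection `C`: `K̂(X,Y)Z = C_X C_Y Z - C_Y C_X Z - C_{[X,Y]} Z`. -/
def connectionCurvature (g : Metric n M) (D D' : Distribution n M) (X Y Z : Field n M) :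
    Field n M :=
  connection g D D' X (connection g D D' Y Z) - connection g D D' Y (connection g D D' X Z)
    - connection g D D' (mlieBracket (𝓡 n) X Y) Z

/-- The curvature tensor of the distribution `D`: `K(X,Y)Z = K̂(X,Y)(HZ)`. -/
def curvature (g : Metric n M) (D D' : Distribution n M) (X Y Z : Field n M) : Field n M :=
  connectionCurvature g D D' X Y (hor D D' Z)

open Classical in
/-- A smooth vector field with the value `u` at `p`. -/
def smoothExtension (p : M) (u : TangentSpace (𝓡 n) p) : Field n M :=
  if h : ∃ X : Field n M, IsSmooth X ∧ X p = u then h.choose else 0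

/-- The value `K(u,v)w` of the curvature tensor on vectors at `p`. -/
def curvatureAt (g : Metric n M) (D D' : Distribution n M) (p : M)
    (u v w : TangentSpace (𝓡 n) p) : TangentSpace (𝓡 n) p :=
  curvature g D D' (smoothExtension p u) (smoothExtension p v) (smoothExtension p w) p

/-- The sectional curvature `K_{uv} = (K(u,v)v, u) / ‖u ∧ v‖²` of the plane spanned by linearly
independent `u, v ∈ D(p)`. -/
def sectionalCurvature (g : Metric n M) (D D' : Distribution n M) (p : M)
    (u v : TangentSpace (𝓡 n) p) : ℝ :=
  g p (curvatureAt g D D' p u v v) u / (g p u u * g p v v - g p u v ^ 2)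

/-- The family `e` is an orthonormal basis of `D(p)`. -/
structure IsOrthonormalBasisOf (g : Metric n M) (D : Distribution n M) (p : M) {m : ℕ}
    (e : Fin m → TangentSpace (𝓡 n) p) : Prop where
  orthonormal : ∀ i j, g p (e i) (e j) = if i = j then 1 else 0
  span_eq : Submodule.span ℝ (Set.range e) = D p

/-- The Ricci curvature `k_w = ∑ᵢ (K(eᵢ,w)w, eᵢ) / ‖w‖²` in the direction of `0 ≠ w ∈ D(p)`, where
`e` is an orthonormal basis of `D(p)`. -/
def ricciCurvature (g : Metric n M) (D D' : Distribution n M) (p : M) {m : ℕ}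
    (e : Fin m → TangentSpace (𝓡 n) p) (w : TangentSpace (𝓡 n) p) : ℝ :=
  (∑ i, g p (curvatureAt g D D' p (e i) w w) (e i)) / g p w w

/-- The scalar curvature `s = ∑ⱼ k_{eⱼ}` at `p`, where `e` is an orthonormal basis of `D(p)`. -/
def scalarCurvature (g : Metric n M) (D D' : Distribution n M) (p : M) {m : ℕ}
    (e : Fin m → TangentSpace (𝓡 n) p) : ℝ :=
  ∑ j, ricciCurvature g D D' p e (e j)

/-- All curvatures of the metrized distribution `D` with rigging `D'` vanish. -/
structure HasZeroCurvatures (g : Metric n M) (D D' : Distribution n M) : Prop where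
  tensor : ∀ X Y Z : Field n M, IsSmooth X → IsSmooth Y → IsSmooth Z →
    ∀ p, curvature g D D' X Y Z p = 0
  sectional : ∀ (p : M) (u v : TangentSpace (𝓡 n) p), u ∈ D p → v ∈ D p →
    LinearIndependent ℝ ![u, v] → sectionalCurvature g D D' p u v = 0
  ricci : ∀ (p : M) (m : ℕ) (e : Fin m → TangentSpace (𝓡 n) p), IsOrthonormalBasisOf g D p e →
    ∀ w ∈ D p, w ≠ 0 → ricciCurvature g D D' p e w = 0
  scalar : ∀ (p : M) (m : ℕ) (e : Fin m → TangentSpace (𝓡 n) p), IsOrthonormalBasisOf g D p e →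
    scalarCurvature g D D' p e = 0

end General

end

end Solovev

/-! ### Left-invariant objects on Lie groups, Carnot groups -/

noncomputable section

section LieGroups

variable {n : ℕ} {G : Type*} [TopologicalSpace G] [ChartedSpace (EuclideanSpace ℝ (Fin n)) G]
  [Group G]

/-- The left-invariant metric on `G` with the value `B` at the identity:
`(u, v)_p = B (dL_{p⁻¹} u) (dL_{p⁻¹} v)`. -/
def leftInvariantMetric (B : LinearMap.BilinForm ℝ (GroupLieAlgebra (𝓡 n) G)) :
    Solovev.Metric n G := fun p =>
  let τ : TangentSpace (𝓡 n) p →ₗ[ℝ] GroupLieAlgebra (𝓡 n) G :=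
    (mfderiv (𝓡 n) (𝓡 n) (fun q : G => p⁻¹ * q) p).toLinearMap
  B.compl₁₂ τ τ

/-- The left-invariant distribution on `G` with the value `P` at the identity:
`D(p) = dL_p (P)`. -/
def leftInvariantDistribution (P : Submodule ℝ (GroupLieAlgebra (𝓡 n) G)) :
    Solovev.Distribution n G := fun p =>
  let τ : GroupLieAlgebra (𝓡 n) G →ₗ[ℝ] TangentSpace (𝓡 n) p :=
    (mfderiv (𝓡 n) (𝓡 n) (fun q : G => p * q) 1).toLinearMap
  P.map τ

variable [LieGroup (𝓡 n) ∞ G]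

/-- Every left-invariant 1-form vanishing on `Q` vanishes on all brackets of left-invariant
vector fields. -/
def FormsKillBrackets (Q : Submodule ℝ (GroupLieAlgebra (𝓡 n) G)) : Prop :=
  ∀ α : Module.Dual ℝ (GroupLieAlgebra (𝓡 n) G), (∀ w ∈ Q, α w = 0) →
    ∀ W X : GroupLieAlgebra (𝓡 n) G, α ⁅W, X⁆ = 0

/-- A rigging of the left-invariant distribution with value `P` at the identity (given by its own
value `Q` at the identity) that is naturally assigned by the condition `ωᵢ[W, X] = 0` for all
left-invariant `W`, `X` and all left-invariant forms `ωᵢ` defining the rigging: the condition holds,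
and `P` alone determines the rigging. -/
structure IsNaturalRigging (P Q : Submodule ℝ (GroupLieAlgebra (𝓡 n) G)) : Prop where
  isCompl : IsCompl P Q
  formsKillBrackets : FormsKillBrackets Q
  unique : ∀ Q' : Submodule ℝ (GroupLieAlgebra (𝓡 n) G),
    IsCompl P Q' → FormsKillBrackets Q' → Q' = Q

variable (n G) in
/-- A one-parameter multiplicative group of automorphisms `δ_s`, `s > 0`, of the Lie group `G`. -/
structure Dilations where
  δ : {s : ℝ // 0 < s} →* MulAut G
  smooth : ∀ s, ContMDiff (𝓡 n) (𝓡 n) ∞ (δ s)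

/-- The differential of `δ_s` at the identity. -/
def Dilations.differential (Δ : Dilations n G) (s : {s : ℝ // 0 < s}) :
    GroupLieAlgebra (𝓡 n) G →ₗ[ℝ] GroupLieAlgebra (𝓡 n) G :=
  (mfderiv (𝓡 n) (𝓡 n) (fun q : G => Δ.δ s q) 1).toLinearMap

/-- The layer `𝔤_k = {v ∈ 𝔤 : dδ_s(v) = s^k v for all s > 0}`. -/
def Dilations.layer (Δ : Dilations n G) (k : ℕ) : Submodule ℝ (GroupLieAlgebra (𝓡 n) G) :=
  ⨅ s : {s : ℝ // 0 < s}, LinearMap.eqLocus (Δ.differential s) ((s : ℝ) ^ k • LinearMap.id)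

/-- `G` with the dilations `Δ` is a Carnot group: `𝔤_1` generates the Lie algebra `𝔤`. -/
def Dilations.IsCarnot (Δ : Dilations n G) : Prop :=
  LieSubalgebra.lieSpan ℝ (GroupLieAlgebra (𝓡 n) G)
    (Δ.layer 1 : Set (GroupLieAlgebra (𝓡 n) G)) = ⊤

/-- The sum of the layers `𝔤_k`, `k ≥ 2`. -/
def Dilations.rigging (Δ : Dilations n G) : Submodule ℝ (GroupLieAlgebra (𝓡 n) G) :=
  ⨆ k : ℕ, ⨆ _ : 2 ≤ k, Δ.layer k

/-- The scalar product `B` on `𝔤` extends the scalar product `q` on `P`, and `Q` is orthogonal to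
`P` with respect to `B`. -/
structure IsAdapted {P : Submodule ℝ (GroupLieAlgebra (𝓡 n) G)} (q : LinearMap.BilinForm ℝ P)
    (Q : Submodule ℝ (GroupLieAlgebra (𝓡 n) G))
    (B : LinearMap.BilinForm ℝ (GroupLieAlgebra (𝓡 n) G)) : Prop where
  isScalarProduct : IsScalarProduct B
  restrict : ∀ u v : P, B u v = q u v
  orthogonal : ∀ u ∈ P, ∀ w ∈ Q, B u w = 0

end LieGroups

end

/-! Left translation turns vector fields into functions `G → 𝔤`, and left-invariant fields into
constants. In these coordinates the Levi-Civita connection is differentiation plus an algebraic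
Koszul term `Γ` (`coord_leviCivita`), and everything rests on one fact: all brackets of `𝔤` lie in
`D^⊥(e)`, orthogonal to `𝔤_1`.

For the curvatures, let `x, y, z` be the coordinates of `X, HY, HZ`. Of the three Koszul terms of
`(Γ(x,y), z)`, orthogonality leaves only `-½([y,z], x)`. It also kills the horizontal part of `Γ` on
horizontal vectors, so `T(HY,HZ)` has coordinates `-[y,z]`, and the torsion correction in `C`
cancels the surviving term. Hence `C_X Y` is the horizontal part of the derivative of `Y` in the
left-invariant frame (`coord_connection`). This connection is flat because `[X,Y]` acts on functions
as the commutator of derivations (`der_mlieBracket`).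

For the rigging, dilations are automorphisms, so `[𝔤_i,𝔤_j] ⊆ 𝔤_{i+j}` (`lie_mem_layer`). Thus `𝔤_1
+ ⨁_{k≥2} 𝔤_k` is a subalgebra containing the generators, hence all of `𝔤`, and brackets have degree
at least 2. Conversely, any subspace containing all brackets contains `D^⊥(e)` (`rigging_le`), which
forces uniqueness. -/

noncomputable section

namespace LieGroupFrame

open Solovev Bundle

/-! ### Left trivialization of the tangent bundle. -/

section

/-- All tangent spaces are definitionally the model space, so base points such as `p * 1` and `p`
can be identified without transporting vectors. -/
theorem tangentBundle_mk_eq {n : ℕ} {M : Type*} [TopologicalSpace M]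
    [ChartedSpace (EuclideanSpace ℝ (Fin n)) M] {p r : M} (h : r = p)
    {v w : EuclideanSpace ℝ (Fin n)} (hv : w = v) :
    (TotalSpace.mk' (EuclideanSpace ℝ (Fin n)) r w : TangentBundle (𝓡 n) M) =
      TotalSpace.mk' _ p v := by
  subst h hv; rfl

variable {n : ℕ} {G : Type*} [TopologicalSpace G] [ChartedSpace (EuclideanSpace ℝ (Fin n)) G]
  [Group G]

/-- Left translation of tangent vectors at `p` to the identity. -/
def toModel (p : G) : TangentSpace (𝓡 n) p →L[ℝ] EuclideanSpace ℝ (Fin n) :=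
  mfderiv (𝓡 n) (𝓡 n) (fun q : G => p⁻¹ * q) p

/-- Left translation of tangent vectors at the identity to `p`. -/
def ofModel (p : G) : EuclideanSpace ℝ (Fin n) →L[ℝ] TangentSpace (𝓡 n) p :=
  mfderiv (𝓡 n) (𝓡 n) (fun q : G => p * q) 1

/-- The coordinates of a vector field in the left trivialization of the tangent bundle. -/
def coord (X : Field n G) (p : G) : EuclideanSpace ℝ (Fin n) := toModel p (X p)

/-- The vector field with given coordinates in the left trivialization. -/
def ofCoord (x : G → EuclideanSpace ℝ (Fin n)) : Field n G := fun p => ofModel p (x p)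

theorem contMDiff_mk_one_iff {x : G → EuclideanSpace ℝ (Fin n)} [IsManifold (𝓡 n) ∞ G]:
    ContMDiff (𝓡 n) (𝓡 n).tangent ∞
      (fun p => (TotalSpace.mk' _ (1 : G) (x p) : TangentBundle (𝓡 n) G)) ↔
    ContMDiff (𝓡 n) 𝓘(ℝ, EuclideanSpace ℝ (Fin n)) ∞ x := by
  rw [(trivializationAt (EuclideanSpace ℝ (Fin n)) (TangentSpace (𝓡 n)) (1 : G)).contMDiff_iff]
  · have : (fun p => ((trivializationAt (EuclideanSpace ℝ (Fin n)) (TangentSpace (𝓡 n)) (1 : G))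
        (TotalSpace.mk' _ (1 : G) (x p))).2) = x := by
      funext p
      rw [TangentBundle.trivializationAt_apply]
      exact (tangentBundleCore (𝓡 n) G).coordChange_self (achart _ (1 : G)) 1
        (mem_achart_source _ _) (x p)
    exact ⟨fun h => this ▸ h.2, fun h => ⟨contMDiff_const, this.symm ▸ h⟩⟩
  · intro p
    rw [TangentBundle.trivializationAt_source]
    exact mem_chart_source _ _

variable [LieGroup (𝓡 n) ∞ G]

/-- The free base point `r` lets the chain rule apply at points like `p * 1`, which equal `p` only
propositionally. -/
theorem hasMFDerivAt_inv_mul {p r : G} (h : r = p) :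
    HasMFDerivAt (𝓡 n) (𝓡 n) (fun q : G => p⁻¹ * q) r
      (toModel p : EuclideanSpace ℝ (Fin n) →L[ℝ] EuclideanSpace ℝ (Fin n)) := by
  subst h
  exact ((contMDiff_mul_left (I := 𝓡 n) (n := ∞) (G := G)).contMDiffAt.mdifferentiableAt
    (by simp)).hasMFDerivAt

theorem hasMFDerivAt_mul {p r : G} (h : r = 1) :
    HasMFDerivAt (𝓡 n) (𝓡 n) (fun q : G => p * q) r
      (ofModel p : EuclideanSpace ℝ (Fin n) →L[ℝ] EuclideanSpace ℝ (Fin n)) := by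
  subst h
  exact ((contMDiff_mul_left (I := 𝓡 n) (n := ∞) (G := G)).contMDiffAt.mdifferentiableAt
    (by simp)).hasMFDerivAt

theorem toModel_ofModel (p : G) (v : EuclideanSpace ℝ (Fin n)) :
    toModel p (ofModel p v) = v := by
  have h := (hasMFDerivAt_inv_mul (n := n) (mul_one p)).comp (1 : G) (hasMFDerivAt_mul (p := p) rfl)
  have e : (fun q : G => p⁻¹ * q) ∘ (fun q : G => p * q) = id := by ext x; simp
  rw [e] at h
  exact congrArg (fun f => f v) (hasMFDerivAt_unique h (hasMFDerivAt_id 1))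

theorem ofModel_toModel (p : G) (v : TangentSpace (𝓡 n) p) :
    ofModel p (toModel p v) = v := by
  have h := (hasMFDerivAt_mul (n := n) (p := p) (inv_mul_cancel p)).comp p
    (hasMFDerivAt_inv_mul rfl)
  have e : (fun q : G => p * q) ∘ (fun q : G => p⁻¹ * q) = id := by ext x; simp
  rw [e] at h
  exact congrArg (fun f => f v) (hasMFDerivAt_unique h (hasMFDerivAt_id p))

@[simp]
theorem coord_ofCoord (x : G → EuclideanSpace ℝ (Fin n)) : coord (ofCoord x) = x :=
  funext fun p => toModel_ofModel p (x p)

@[simp]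
theorem ofCoord_coord (X : Field n G) : ofCoord (coord X) = X :=
  funext fun p => ofModel_toModel p (X p)

theorem coord_injective : Function.Injective (coord : Field n G → _) :=
  Function.LeftInverse.injective ofCoord_coord

theorem mfderiv_mul_zero_left {p q : G} (v : TangentSpace (𝓡 n) q) :
    mfderiv ((𝓡 n).prod (𝓡 n)) (𝓡 n) (fun r : G × G => r.1 * r.2) (p, q)
      ((0, v) : TangentSpace (𝓡 n) p × TangentSpace (𝓡 n) q) =
    mfderiv (𝓡 n) (𝓡 n) (fun r : G => p * r) q v := by
  refine (mfderiv_prod_eq_add_apply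
    ((contMDiff_mul (𝓡 n) ∞).mdifferentiableAt (by simp))).trans ?_
  exact (congrArg₂ (· + ·) (map_zero _) rfl).trans (zero_add _)

/-- The translation varies with `p`, so smoothness comes from the tangent map of the multiplication
`G × G → G`, evaluated on the zero vector at `f p` and on `Y p`. Taking `f = id` and `f = (·)⁻¹`
gives the two directions of the trivialization. -/
theorem contMDiff_mul_zero_left {f : G → G} (hf : ContMDiff (𝓡 n) (𝓡 n) ∞ f)
    {Y : G → TangentBundle (𝓡 n) G} (hY : ContMDiff (𝓡 n) (𝓡 n).tangent ∞ Y) :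
    ContMDiff (𝓡 n) (𝓡 n).tangent ∞ (fun p => (TotalSpace.mk' _ (f p * (Y p).1)
      (mfderiv (𝓡 n) (𝓡 n) (fun r : G => f p * r) (Y p).1 (Y p).2) : TangentBundle (𝓡 n) G)) := by
  have : IsManifold (𝓡 n) (∞ + 1) G := inferInstanceAs (IsManifold (𝓡 n) ∞ G)
  have S₁ : ContMDiff (𝓡 n) (𝓡 n).tangent ∞
      (fun p => (TotalSpace.mk' _ (f p) 0 : TangentBundle (𝓡 n) G)) :=
    (contMDiff_zeroSection ℝ (TangentSpace (𝓡 n) : G → Type _)).comp hf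
  have S₂ : ContMDiff _ _ ∞ (equivTangentBundleProd (𝓡 n) G (𝓡 n) G).symm :=
    contMDiff_equivTangentBundleProd_symm
  have S₃ : ContMDiff ((𝓡 n).prod (𝓡 n)).tangent (𝓡 n).tangent ∞
      (tangentMap ((𝓡 n).prod (𝓡 n)) (𝓡 n) (fun p : G × G ↦ p.1 * p.2)) :=
    (contMDiff_mul (𝓡 n) ∞).contMDiff_tangentMap (by simp)
  refine ((S₃.comp S₂).comp (S₁.prodMk hY)).congr fun p => ?_
  exact tangentBundle_mk_eq rfl (mfderiv_mul_zero_left (Y p).2).symm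

theorem isSmooth_ofCoord {x : G → EuclideanSpace ℝ (Fin n)}
    (hx : ContMDiff (𝓡 n) 𝓘(ℝ, EuclideanSpace ℝ (Fin n)) ∞ x) : IsSmooth (ofCoord x) := by
  refine (contMDiff_mul_zero_left contMDiff_id (contMDiff_mk_one_iff.2 hx)).congr fun p => ?_
  exact tangentBundle_mk_eq (mul_one p).symm rfl

theorem contMDiff_coord {X : Field n G} (hX : IsSmooth X) :
    ContMDiff (𝓡 n) 𝓘(ℝ, EuclideanSpace ℝ (Fin n)) ∞ (coord X) := by
  refine contMDiff_mk_one_iff.1 ?_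
  refine (contMDiff_mul_zero_left (contMDiff_inv (𝓡 n) ∞) hX).congr fun p => ?_
  exact tangentBundle_mk_eq (inv_mul_cancel p).symm rfl

end

/-! ### Derivatives and Lie brackets in left-invariant coordinates. -/

section

variable {n : ℕ} {G : Type*} [TopologicalSpace G] [ChartedSpace (EuclideanSpace ℝ (Fin n)) G]

/-- The derivative along `X` of a function with values in the model space. -/
def der (X : Field n G) (y : G → EuclideanSpace ℝ (Fin n)) (p : G) : EuclideanSpace ℝ (Fin n) :=
  mfderiv (𝓡 n) 𝓘(ℝ, EuclideanSpace ℝ (Fin n)) y p (X p)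

theorem der_map (X : Field n G) {y : G → EuclideanSpace ℝ (Fin n)} {p : G}
    (hy : MDifferentiableAt (𝓡 n) 𝓘(ℝ, EuclideanSpace ℝ (Fin n)) y p)
    (L : EuclideanSpace ℝ (Fin n) →ₗ[ℝ] EuclideanSpace ℝ (Fin n)) :
    der X (fun q => L (y q)) p = L (der X y p) := by
  have h := (LinearMap.toContinuousLinearMap L).hasFDerivAt (x := y p)
    |>.hasMFDerivAt.comp p hy.hasMFDerivAt
  exact congrArg (fun f => f (X p)) h.mfderiv

theorem dirDeriv_map (X : Field n G) {y : G → EuclideanSpace ℝ (Fin n)} {p : G}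
    (hy : MDifferentiableAt (𝓡 n) 𝓘(ℝ, EuclideanSpace ℝ (Fin n)) y p)
    (L : EuclideanSpace ℝ (Fin n) →ₗ[ℝ] ℝ) :
    dirDeriv X (fun q => L (y q)) p = L (der X y p) := by
  have h := (LinearMap.toContinuousLinearMap L).hasFDerivAt (x := y p)
    |>.hasMFDerivAt.comp p hy.hasMFDerivAt
  exact congrArg (fun f => f (X p)) h.mfderiv

theorem dirDeriv_bilin (X : Field n G) {y z : G → EuclideanSpace ℝ (Fin n)} {p : G}
    (hy : MDifferentiableAt (𝓡 n) 𝓘(ℝ, EuclideanSpace ℝ (Fin n)) y p)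
    (hz : MDifferentiableAt (𝓡 n) 𝓘(ℝ, EuclideanSpace ℝ (Fin n)) z p)
    (B : LinearMap.BilinForm ℝ (EuclideanSpace ℝ (Fin n))) :
    dirDeriv X (fun q => B (y q) (z q)) p = B (der X y p) (z p) + B (y p) (der X z p) := by
  let C := LinearMap.toContinuousBilinearMap B
  have h : HasMFDerivAt (𝓡 n) 𝓘(ℝ, ℝ) (fun q => C (y q) (z q)) p
      (C.precompR _ (y p) (mfderiv (𝓡 n) 𝓘(ℝ, EuclideanSpace ℝ (Fin n)) z p) +
        C.precompL _ (mfderiv (𝓡 n) 𝓘(ℝ, EuclideanSpace ℝ (Fin n)) y p) (z p) :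
        EuclideanSpace ℝ (Fin n) →L[ℝ] ℝ) := by
    refine ⟨(C.isBoundedBilinearMap.continuous.continuousAt).comp
      (hy.continuousAt.prodMk hz.continuousAt), ?_⟩
    have := C.hasFDerivWithinAt_of_bilinear hy.hasMFDerivAt.2 hz.hasMFDerivAt.2
    have hy' : writtenInExtChartAt (𝓡 n) 𝓘(ℝ, EuclideanSpace ℝ (Fin n)) p y
        (extChartAt (𝓡 n) p p) = y p :=
      congrArg y ((extChartAt (𝓡 n) p).left_inv (mem_extChartAt_source p))
    have hz' : writtenInExtChartAt (𝓡 n) 𝓘(ℝ, EuclideanSpace ℝ (Fin n)) p z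
        (extChartAt (𝓡 n) p p) = z p :=
      congrArg z ((extChartAt (𝓡 n) p).left_inv (mem_extChartAt_source p))
    rw [hy', hz'] at this
    exact this
  exact (congrArg (fun f => f (X p)) h.mfderiv).trans (add_comm _ _)

variable [Group G]

theorem ofCoord_eq_sum (y : G → EuclideanSpace ℝ (Fin n)) :
    ofCoord y = ∑ a, (fun p => y p a) • ofCoord (fun _ => EuclideanSpace.basisFun (Fin n) ℝ a) := by
  funext p
  rw [Finset.sum_apply]
  conv_lhs => rw [ofCoord, ← (EuclideanSpace.basisFun (Fin n) ℝ).sum_repr (y p), map_sum]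
  refine Finset.sum_congr rfl fun a _ => ?_
  rw [map_smul]
  simp [ofCoord]

variable [LieGroup (𝓡 n) ∞ G]

variable (n G) in
/-- The Lie bracket of the Lie algebra as a bilinear map on the model space. -/
def bracket : EuclideanSpace ℝ (Fin n) →ₗ[ℝ] EuclideanSpace ℝ (Fin n) →ₗ[ℝ]
    EuclideanSpace ℝ (Fin n) :=
  (LieModule.toEnd ℝ (GroupLieAlgebra (𝓡 n) G) (GroupLieAlgebra (𝓡 n) G) :
    GroupLieAlgebra (𝓡 n) G →ₗ[ℝ] Module.End ℝ (GroupLieAlgebra (𝓡 n) G))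

theorem mlieBracket_const (u v : EuclideanSpace ℝ (Fin n)) :
    mlieBracket (𝓡 n) (ofCoord (G := G) fun _ => u) (ofCoord fun _ => v) =
      ofCoord fun _ => bracket n G u v :=
  (mulInvariantVector_mlieBracket (I := 𝓡 n) (G := G) u v).symm

theorem isSmooth_const (u : EuclideanSpace ℝ (Fin n)) : IsSmooth (ofCoord (G := G) fun _ => u) :=
  isSmooth_ofCoord contMDiff_const

theorem IsSmooth.mdifferentiableAt {X : Field n G} (hX : IsSmooth X) (p : G) :
    MDifferentiableAt (𝓡 n) (𝓡 n).tangent (fun p => (⟨p, X p⟩ : TangentBundle (𝓡 n) G)) p :=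
  ContMDiff.mdifferentiable hX (by simp) p

theorem mlieBracket_fmul {V W : Field n G} {f : G → ℝ} {p : G}
    (hf : MDifferentiableAt (𝓡 n) 𝓘(ℝ, ℝ) f p) (hW : IsSmooth W) :
    mlieBracket (𝓡 n) V (f • W) p = dirDeriv V f p • W p + f p • mlieBracket (𝓡 n) V W p :=
  mlieBracket_smul_right hf (IsSmooth.mdifferentiableAt hW p)

theorem mlieBracket_sum (V : Field n G) {ι : Type*} (s : Finset ι) (W : ι → Field n G)
    (hW : ∀ i, IsSmooth (W i)) (p : G) :
    mlieBracket (𝓡 n) V (∑ i ∈ s, W i) p = ∑ i ∈ s, mlieBracket (𝓡 n) V (W i) p := by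
  classical
  have hs : ∀ s : Finset ι, MDifferentiableAt (𝓡 n) (𝓡 n).tangent
      (fun p => (⟨p, (∑ i ∈ s, W i) p⟩ : TangentBundle (𝓡 n) G)) p := by
    intro s
    have h : ContMDiff (𝓡 n) (𝓡 n).tangent ∞
        (fun p => (⟨p, ∑ i ∈ s, W i p⟩ : TangentBundle (𝓡 n) G)) :=
      ContMDiff.sum_section fun i _ => hW i
    simpa only [Finset.sum_apply] using ContMDiff.mdifferentiable h (by simp) p
  induction s using Finset.induction_on with
  | empty => simp
  | insert a s ha ih =>
    rw [Finset.sum_insert ha, Finset.sum_insert ha, mlieBracket_add_right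
      (IsSmooth.mdifferentiableAt (hW a) p) (hs s), ih]

/-- Derivation rule in the left trivialization, one-sided version. -/
theorem mlieBracket_ofCoord (V : Field n G) {y : G → EuclideanSpace ℝ (Fin n)}
    (hy : ContMDiff (𝓡 n) 𝓘(ℝ, EuclideanSpace ℝ (Fin n)) ∞ y) (p : G) :
    mlieBracket (𝓡 n) V (ofCoord y) p = ofModel p (der V y p) +
      mlieBracket (𝓡 n) V (ofCoord fun _ => y p) p := by
  have hc : ∀ a, ContMDiff (𝓡 n) 𝓘(ℝ, ℝ) ∞ (fun q => y q a) := fun a =>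
    (EuclideanSpace.proj (𝕜 := ℝ) a).contMDiff.comp hy
  have hs : ∀ z : G → EuclideanSpace ℝ (Fin n),
      ContMDiff (𝓡 n) 𝓘(ℝ, EuclideanSpace ℝ (Fin n)) ∞ z → ∀ a, IsSmooth
      ((fun p => z p a) • ofCoord (G := G) fun _ => EuclideanSpace.basisFun (Fin n) ℝ a) := by
    intro z hz a
    have : ((fun p => z p a) • ofCoord (G := G) fun _ => EuclideanSpace.basisFun (Fin n) ℝ a) =
        ofCoord fun p => z p a • EuclideanSpace.basisFun (Fin n) ℝ a := by
      funext p; simp [ofCoord]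
    rw [this]
    exact isSmooth_ofCoord
      (((EuclideanSpace.proj (𝕜 := ℝ) a).contMDiff.comp hz).smul contMDiff_const)
  have hd : ∀ a, dirDeriv V (fun q => y q a) p = der V y p a := fun a =>
    dirDeriv_map V (hy.mdifferentiable (by simp) p)
      (EuclideanSpace.proj (𝕜 := ℝ) a).toLinearMap
  have key : ∀ z : G → EuclideanSpace ℝ (Fin n),
      ContMDiff (𝓡 n) 𝓘(ℝ, EuclideanSpace ℝ (Fin n)) ∞ z →
      mlieBracket (𝓡 n) V (ofCoord z) p = ∑ a, (dirDeriv V (fun q => z q a) p •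
        ofModel p (EuclideanSpace.basisFun (Fin n) ℝ a) + z p a • mlieBracket (𝓡 n) V
          (ofCoord fun _ => EuclideanSpace.basisFun (Fin n) ℝ a) p) := by
    intro z hz
    rw [ofCoord_eq_sum z, mlieBracket_sum V _ _ (hs z hz)]
    refine Finset.sum_congr rfl fun a _ => ?_
    exact mlieBracket_fmul (((EuclideanSpace.proj (𝕜 := ℝ) a).contMDiff.comp hz).mdifferentiable
      (by simp) p) (isSmooth_const _)
  -- The frame expansions of `y` and of the constant `y p` differ at `p` only in the terms
  -- differentiating the coefficients.
  rw [key y hy, key _ contMDiff_const, Finset.sum_add_distrib, Finset.sum_add_distrib, ← add_assoc]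
  congr 1
  have h0 : ∀ a, dirDeriv V (fun _ => y p a) p = 0 := fun a => by
    simp only [dirDeriv, mfderiv_const]; rfl
  simp only [h0, hd, zero_smul, Finset.sum_const_zero, add_zero]
  conv_rhs => rw [← (EuclideanSpace.basisFun (Fin n) ℝ).sum_repr (der V y p), map_sum]
  simp only [map_smul, EuclideanSpace.basisFun_repr]

/-- The one-sided rule freezes `Y` to the left-invariant field with the same value at `p`;
antisymmetry and the same rule then freeze `X`, leaving the bracket of two left-invariant fields. -/
theorem coord_mlieBracket {X Y : Field n G} (hX : IsSmooth X) (hY : IsSmooth Y) (p : G) :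
    coord (mlieBracket (𝓡 n) X Y) p =
      der X (coord Y) p - der Y (coord X) p + bracket n G (coord X p) (coord Y p) := by
  have h1 := mlieBracket_ofCoord X (contMDiff_coord hY) p
  have h2 := mlieBracket_ofCoord (ofCoord fun _ => coord Y p) (contMDiff_coord hX) p
  rw [ofCoord_coord] at h1 h2
  have h3 : der (ofCoord fun _ => coord Y p) (coord X) p = der Y (coord X) p := by
    have : ofCoord (fun _ => coord Y p) p = Y p := ofModel_toModel p (Y p)
    rw [der, this, der]
  rw [mlieBracket_swap_apply (W := ofCoord fun _ => coord Y p), h2, h3, mlieBracket_const] at h1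
  have h4 : bracket n G (coord Y p) (coord X p) = - bracket n G (coord X p) (coord Y p) :=
    (lie_skew (L := GroupLieAlgebra (𝓡 n) G) (coord Y p) (coord X p)).symm
  rw [coord, h1, ofCoord, h4]
  simp only [map_add, map_neg, toModel_ofModel]
  abel

end

/-! ### The Lie bracket as a commutator of derivations. -/

section

variable {n : ℕ} {G : Type*} [TopologicalSpace G] [ChartedSpace (EuclideanSpace ℝ (Fin n)) G]
  [Group G] [LieGroup (𝓡 n) ∞ G]

theorem contMDiff_der {X : Field n G} (hX : IsSmooth X) {y : G → EuclideanSpace ℝ (Fin n)}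
    (hy : ContMDiff (𝓡 n) 𝓘(ℝ, EuclideanSpace ℝ (Fin n)) ∞ y) :
    ContMDiff (𝓡 n) 𝓘(ℝ, EuclideanSpace ℝ (Fin n)) ∞ (der X y) :=
  (contMDiff_snd_tangentBundle_modelSpace (EuclideanSpace ℝ (Fin n))
    𝓘(ℝ, EuclideanSpace ℝ (Fin n))).comp ((hy.contMDiff_tangentMap (by simp)).comp hX)

theorem contMDiff_dirDeriv {X : Field n G} (hX : IsSmooth X) {f : G → ℝ}
    (hf : ContMDiff (𝓡 n) 𝓘(ℝ, ℝ) ∞ f) : ContMDiff (𝓡 n) 𝓘(ℝ, ℝ) ∞ (dirDeriv X f) :=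
  (contMDiff_snd_tangentBundle_modelSpace ℝ 𝓘(ℝ, ℝ)).comp
    ((hf.contMDiff_tangentMap (by simp)).comp hX)

theorem isSmooth_mlieBracket {X Y : Field n G} (hX : IsSmooth X) (hY : IsSmooth Y) :
    IsSmooth (mlieBracket (𝓡 n) X Y) := fun p =>
  have : IsManifold (𝓡 n) (∞ + 1) G := inferInstanceAs (IsManifold (𝓡 n) ∞ G)
  ContMDiffAt.mlieBracket_vectorField (m := ⊤) (n := ⊤) (hX p) (hY p) (by simp)

theorem isSmooth_fmul {f : G → ℝ} (hf : ContMDiff (𝓡 n) 𝓘(ℝ, ℝ) ∞ f) {X : Field n G}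
    (hX : IsSmooth X) : IsSmooth (f • X) :=
  ContMDiff.smul_section hf hX

theorem mlieBracket_add {V W W' : Field n G} (hW : IsSmooth W) (hW' : IsSmooth W') (p : G) :
    mlieBracket (𝓡 n) V (W + W') p = mlieBracket (𝓡 n) V W p + mlieBracket (𝓡 n) V W' p :=
  mlieBracket_add_right (IsSmooth.mdifferentiableAt hW p) (IsSmooth.mdifferentiableAt hW' p)

theorem mlieBracket_mlieBracket_fmul {X Y W : Field n G} (hY : IsSmooth Y) (hW : IsSmooth W)
    {f : G → ℝ} (hf : ContMDiff (𝓡 n) 𝓘(ℝ, ℝ) ∞ f) (p : G) :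
    mlieBracket (𝓡 n) X (mlieBracket (𝓡 n) Y (f • W)) p =
      dirDeriv X (dirDeriv Y f) p • W p + dirDeriv Y f p • mlieBracket (𝓡 n) X W p +
      (dirDeriv X f p • mlieBracket (𝓡 n) Y W p +
        f p • mlieBracket (𝓡 n) X (mlieBracket (𝓡 n) Y W) p) := by
  have h : mlieBracket (𝓡 n) Y (f • W) = dirDeriv Y f • W + f • mlieBracket (𝓡 n) Y W :=
    funext fun q => mlieBracket_fmul (hf.mdifferentiable (by simp) q) hW
  have hYf := contMDiff_dirDeriv hY hf
  have hYW := isSmooth_mlieBracket hY hW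
  rw [h, mlieBracket_add (isSmooth_fmul hYf hW) (isSmooth_fmul hf hYW),
    mlieBracket_fmul (hYf.mdifferentiable (by simp) p) hW,
    mlieBracket_fmul (hf.mdifferentiable (by simp) p) hYW]

theorem mlieBracket_jacobi {X Y Z : Field n G} (hX : IsSmooth X) (hY : IsSmooth Y)
    (hZ : IsSmooth Z) (p : G) :
    mlieBracket (𝓡 n) X (mlieBracket (𝓡 n) Y Z) p =
      mlieBracket (𝓡 n) (mlieBracket (𝓡 n) X Y) Z p +
        mlieBracket (𝓡 n) Y (mlieBracket (𝓡 n) X Z) p := by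
  have h : minSmoothness ℝ 2 ≤ ∞ := by
    rw [minSmoothness_of_isRCLikeNormedField]
    exact ENat.LEInfty.out
  exact leibniz_identity_mlieBracket_apply ((hX p).of_le h) ((hY p).of_le h) ((hZ p).of_le h)

/-- Expanding the Jacobi identity for `X`, `Y`, `f • W` by the Leibniz rule and subtracting `f`
times the identity for `X`, `Y`, `W` leaves this equation multiplied by `W`. A nonzero
left-invariant `W` vanishes nowhere and can be cancelled; it exists unless the dimension is zero. -/
theorem dirDeriv_mlieBracket {X Y : Field n G} (hX : IsSmooth X) (hY : IsSmooth Y) {f : G → ℝ}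
    (hf : ContMDiff (𝓡 n) 𝓘(ℝ, ℝ) ∞ f) (p : G) :
    dirDeriv (mlieBracket (𝓡 n) X Y) f p =
      dirDeriv X (dirDeriv Y f) p - dirDeriv Y (dirDeriv X f) p := by
  rcases subsingleton_or_nontrivial (EuclideanSpace ℝ (Fin n)) with hE | hE
  · have : ∀ (Z : Field n G) (g : G → ℝ), dirDeriv Z g p = 0 := fun Z g => by
      rw [dirDeriv, show Z p = 0 from hE.elim _ _]
      exact map_zero _
    simp [this]
  · obtain ⟨w, hw⟩ := exists_ne (0 : EuclideanSpace ℝ (Fin n))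
    let W : Field n G := ofCoord fun _ => w
    have hW : IsSmooth W := isSmooth_const w
    have hWp : W p ≠ 0 := fun h => hw <| by
      rw [← toModel_ofModel p w]
      exact (congrArg (toModel p) h).trans (map_zero _)
    have h := mlieBracket_jacobi hX hY (isSmooth_fmul hf hW) p
    rw [mlieBracket_mlieBracket_fmul hY hW hf, mlieBracket_mlieBracket_fmul hX hW hf,
      mlieBracket_fmul (hf.mdifferentiable (by simp) p) hW, mlieBracket_jacobi hX hY hW] at h
    refine smul_left_injective ℝ hWp ?_
    simp only [sub_smul, smul_add] at h ⊢
    rw [eq_sub_iff_add_eq]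
    linear_combination (norm := module) -h

theorem der_mlieBracket {X Y : Field n G} (hX : IsSmooth X) (hY : IsSmooth Y)
    {z : G → EuclideanSpace ℝ (Fin n)}
    (hz : ContMDiff (𝓡 n) 𝓘(ℝ, EuclideanSpace ℝ (Fin n)) ∞ z) (p : G) :
    der (mlieBracket (𝓡 n) X Y) z p = der X (der Y z) p - der Y (der X z) p := by
  ext a
  have hd : ∀ (V : Field n G) (y : G → EuclideanSpace ℝ (Fin n)),
      ContMDiff (𝓡 n) 𝓘(ℝ, EuclideanSpace ℝ (Fin n)) ∞ y →
      (fun q => der V y q a) = dirDeriv V fun q => y q a := fun V y hy => funext fun q =>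
    (dirDeriv_map V (hy.mdifferentiable (by simp) q)
      (EuclideanSpace.proj (𝕜 := ℝ) a).toLinearMap).symm
  have h := dirDeriv_mlieBracket hX hY ((EuclideanSpace.proj (𝕜 := ℝ) a).contMDiff.comp hz) p
  change dirDeriv _ (fun q => z q a) p = dirDeriv X (dirDeriv Y fun q => z q a) p -
    dirDeriv Y (dirDeriv X fun q => z q a) p at h
  rw [← hd Y z hz, ← hd X z hz, ← hd _ z hz, ← hd X _ (contMDiff_der hY hz),
    ← hd Y _ (contMDiff_der hX hz)] at h
  exact h

end

/-! ### Scalar products, projections and the Levi-Civita connection. -/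

section

theorem IsScalarProduct.eq_of_forall {W : Type*} [AddCommGroup W] [Module ℝ W]
    {B : LinearMap.BilinForm ℝ W} (hB : IsScalarProduct B) {u v : W} (h : ∀ w, B u w = B v w) :
    u = v := by
  by_contra hne
  have := hB.pos (u - v) (sub_ne_zero.2 hne)
  have h0 : B (u - v) (u - v) = 0 := by
    rw [map_sub B, LinearMap.sub_apply, h, sub_self]
  rw [h0] at this
  exact lt_irrefl _ this

theorem IsScalarProduct.exists_rep {W : Type*} [AddCommGroup W] [Module ℝ W]
    [FiniteDimensional ℝ W] {B : LinearMap.BilinForm ℝ W} (hB : IsScalarProduct B)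
    (f : W →ₗ[ℝ] ℝ) : ∃ u, ∀ w, B u w = f w := by
  have hinj : Function.Injective B := fun u v h =>
    IsScalarProduct.eq_of_forall hB fun w => by rw [h]
  have hsurj : Function.Surjective B :=
    (LinearMap.injective_iff_surjective_of_finrank_eq_finrank
      (Subspace.dual_finrank_eq (K := ℝ) (V := W)).symm).1 hinj
  obtain ⟨u, hu⟩ := hsurj f
  exact ⟨u, fun w => by rw [hu]⟩

theorem projectionAlong_map {W W' : Type*} [AddCommGroup W] [Module ℝ W] [AddCommGroup W']
    [Module ℝ W'] {P Q : Submodule ℝ W} (h : IsCompl P Q) (τ : W ≃ₗ[ℝ] W') (w : W) :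
    projectionAlong (P.map τ.toLinearMap) (Q.map τ.toLinearMap) (τ w) =
      τ (projectionAlong P Q w) := by
  have h' : IsCompl (P.map τ.toLinearMap) (Q.map τ.toLinearMap) :=
    (Submodule.orderIsoMapComap τ).isCompl_iff.1 h
  rw [projectionAlong, projectionAlong, dif_pos h, dif_pos h']
  conv_lhs => rw [← Submodule.projection_add_projection_eq_self h w]
  have h1 := Submodule.projection_apply_of_mem_left h' (Submodule.mem_map_of_mem
    (f := τ.toLinearMap) (Submodule.projection_apply_mem h w))
  have h2 := (Submodule.projection_apply_eq_zero_iff h').2 (Submodule.mem_map_of_mem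
    (f := τ.toLinearMap) (Submodule.projection_apply_mem h.symm w))
  rw [LinearEquiv.coe_coe] at h1 h2
  rw [map_add, map_add, h1, h2, add_zero]

variable {n : ℕ} {G : Type*} [TopologicalSpace G] [ChartedSpace (EuclideanSpace ℝ (Fin n)) G]

theorem contMDiff_linear_comp (L : EuclideanSpace ℝ (Fin n) →ₗ[ℝ] EuclideanSpace ℝ (Fin n))
    {x : G → EuclideanSpace ℝ (Fin n)}
    (hx : ContMDiff (𝓡 n) 𝓘(ℝ, EuclideanSpace ℝ (Fin n)) ∞ x) :
    ContMDiff (𝓡 n) 𝓘(ℝ, EuclideanSpace ℝ (Fin n)) ∞ (fun p => L (x p)) :=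
  (LinearMap.toContinuousLinearMap L).contMDiff.comp hx

variable [Group G] [LieGroup (𝓡 n) ∞ G]

variable (n) in
/-- Left translation as a linear equivalence. -/
def modelEquiv (p : G) : EuclideanSpace ℝ (Fin n) ≃ₗ[ℝ] TangentSpace (𝓡 n) p :=
  LinearEquiv.ofLinearMap (ofModel p).toLinearMap (toModel p).toLinearMap
    (LinearMap.ext fun v => ofModel_toModel p v) (LinearMap.ext fun v => toModel_ofModel p v)

theorem coord_hor {P Q : Submodule ℝ (EuclideanSpace ℝ (Fin n))} (h : IsCompl P Q)
    (X : Field n G) (p : G) :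
    coord (hor (leftInvariantDistribution (G := G) P) (leftInvariantDistribution Q) X) p =
      projectionAlong P Q (coord X p) := by
  have := projectionAlong_map h (modelEquiv n p) (coord X p)
  rw [show modelEquiv n p (coord X p) = X p from ofModel_toModel p (X p)] at this
  refine (congrArg (toModel p) this).trans (toModel_ofModel p _)

theorem hor_eq {P Q : Submodule ℝ (EuclideanSpace ℝ (Fin n))} (h : IsCompl P Q)
    (X : Field n G) :
    hor (leftInvariantDistribution (G := G) P) (leftInvariantDistribution Q) X =
      ofCoord fun p => projectionAlong P Q (coord X p) :=
  coord_injective (funext fun p => by rw [coord_hor h, coord_ofCoord])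

theorem isSmooth_hor {P Q : Submodule ℝ (EuclideanSpace ℝ (Fin n))} (h : IsCompl P Q)
    {X : Field n G} (hX : IsSmooth X) :
    IsSmooth (hor (leftInvariantDistribution (G := G) P) (leftInvariantDistribution Q) X) := by
  rw [hor_eq h]
  exact isSmooth_ofCoord (contMDiff_linear_comp _ (contMDiff_coord hX))

section Metric

variable {B : LinearMap.BilinForm ℝ (EuclideanSpace ℝ (Fin n))}

/-- Testing against left-invariant fields already determines the vector, since these take every
value at `p` and `B` is definite. -/
theorem representative_eq (hB : IsScalarProduct B) {p : G} {Φ : Field n G → ℝ}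
    {w : EuclideanSpace ℝ (Fin n)} (hw : ∀ Z : Field n G, IsSmooth Z → B w (coord Z p) = Φ Z) :
    toModel p (representative (leftInvariantMetric B) p Φ) = w := by
  have h : ∃ w : TangentSpace (𝓡 n) p, ∀ Z : Field n G, IsSmooth Z →
      leftInvariantMetric B p w (Z p) = Φ Z := by
    refine ⟨ofModel p w, fun Z hZ => ?_⟩
    rw [← hw Z hZ]
    exact congrArg (fun u => B u (coord Z p)) (toModel_ofModel p w)
  rw [representative, dif_pos h]
  refine IsScalarProduct.eq_of_forall hB fun v => ?_
  have h1 := h.choose_spec _ (isSmooth_const (G := G) v)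
  have h2 := hw _ (isSmooth_const (G := G) v)
  rw [coord_ofCoord] at h2
  rw [h2, ← h1]
  exact congrArg (B _) (toModel_ofModel p v).symm

/-- `Γ` is the algebraic part of the Levi-Civita connection of the left-invariant metric `B`. -/
def IsKoszul (br : EuclideanSpace ℝ (Fin n) →ₗ[ℝ] EuclideanSpace ℝ (Fin n) →ₗ[ℝ]
    EuclideanSpace ℝ (Fin n)) (B : LinearMap.BilinForm ℝ (EuclideanSpace ℝ (Fin n)))
    (Γ : EuclideanSpace ℝ (Fin n) → EuclideanSpace ℝ (Fin n) → EuclideanSpace ℝ (Fin n)) : Prop :=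
  ∀ u v w, B (Γ u v) w = (1 / 2) * (B (br u v) w - B (br v w) u + B (br w u) v)

/-- `Γ u v` is chosen separately for each pair by Riesz representation; bilinearity is not recorded,
as the Koszul identity supplies all that is used later. -/
theorem exists_isKoszul (br : EuclideanSpace ℝ (Fin n) →ₗ[ℝ] EuclideanSpace ℝ (Fin n) →ₗ[ℝ]
    EuclideanSpace ℝ (Fin n)) (hB : IsScalarProduct B) : ∃ Γ, IsKoszul br B Γ := by
  have h : ∀ u v, ∃ g, ∀ w, B g w = (1 / 2) * (B (br u v) w - B (br v w) u + B (br w u) v) :=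
    fun u v => IsScalarProduct.exists_rep hB
      ((1 / 2 : ℝ) • (B (br u v) - B.flip u ∘ₗ br v + B.flip v ∘ₗ br.flip u))
  choose Γ hΓ using h
  exact ⟨Γ, hΓ⟩

/-- By symmetry of `B`, the derivative terms in Koszul's formula cancel except for two copies of `B
(der X (coord Y) p) (coord Z p)`; the bracket terms give `Γ`. -/
theorem coord_leviCivita (hB : IsScalarProduct B)
    {Γ : EuclideanSpace ℝ (Fin n) → EuclideanSpace ℝ (Fin n) → EuclideanSpace ℝ (Fin n)}
    (hΓ : IsKoszul (bracket n G) B Γ) {X Y : Field n G} (hX : IsSmooth X) (hY : IsSmooth Y)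
    (p : G) :
    coord (leviCivita (leftInvariantMetric B) X Y) p =
      der X (coord Y) p + Γ (coord X p) (coord Y p) := by
  refine representative_eq hB fun Z hZ => ?_
  have d : ∀ {W : Field n G}, IsSmooth W →
      MDifferentiableAt (𝓡 n) 𝓘(ℝ, EuclideanSpace ℝ (Fin n)) (coord W) p := fun hW =>
    (contMDiff_coord hW).mdifferentiable (by simp) p
  have e : ∀ U V : Field n G, pair (leftInvariantMetric B) U V =
      fun q => B (coord U q) (coord V q) := fun _ _ => rfl
  simp only [e]
  rw [dirDeriv_bilin X (d hY) (d hZ), dirDeriv_bilin Y (d hZ) (d hX),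
    dirDeriv_bilin Z (d hX) (d hY), coord_mlieBracket hX hY, coord_mlieBracket hY hZ,
    coord_mlieBracket hZ hX]
  simp only [map_add, map_sub, LinearMap.add_apply, LinearMap.sub_apply]
  rw [hΓ, hB.symm (coord Y p) (der X (coord Z) p), hB.symm (coord Z p) (der Y (coord X) p),
    hB.symm (coord X p) (der Z (coord Y) p)]
  ring

end Metric

end

/-! ### Solov'ev's connection and its flatness. -/

section

variable {n : ℕ} {G : Type*} [TopologicalSpace G] [ChartedSpace (EuclideanSpace ℝ (Fin n)) G]
  [Group G] [LieGroup (𝓡 n) ∞ G]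

theorem projectionAlong_add {W : Type*} [AddCommGroup W] [Module ℝ W] {P Q : Submodule ℝ W}
    (h : IsCompl P Q) (w : W) : projectionAlong P Q w + projectionAlong Q P w = w := by
  rw [projectionAlong, projectionAlong, dif_pos h, dif_pos h.symm]
  exact Submodule.projection_add_projection_eq_self h w

theorem projectionAlong_mem {W : Type*} [AddCommGroup W] [Module ℝ W] {P Q : Submodule ℝ W}
    (h : IsCompl P Q) (w : W) : projectionAlong P Q w ∈ P := by
  rw [projectionAlong, dif_pos h]
  exact Submodule.projection_apply_mem h w

theorem projectionAlong_of_mem_left {W : Type*} [AddCommGroup W] [Module ℝ W]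
    {P Q : Submodule ℝ W} (h : IsCompl P Q) {w : W} (hw : w ∈ P) : projectionAlong P Q w = w := by
  rw [projectionAlong, dif_pos h]
  exact Submodule.projection_apply_of_mem_left h hw

theorem projectionAlong_of_mem_right {W : Type*} [AddCommGroup W] [Module ℝ W]
    {P Q : Submodule ℝ W} (h : IsCompl P Q) {w : W} (hw : w ∈ Q) : projectionAlong P Q w = 0 := by
  rw [projectionAlong, dif_pos h]
  exact (Submodule.projection_apply_eq_zero_iff h).2 hw

section Curvature

variable {B : LinearMap.BilinForm ℝ (EuclideanSpace ℝ (Fin n))}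
  {P Q : Submodule ℝ (EuclideanSpace ℝ (Fin n))}
  {Γ : EuclideanSpace ℝ (Fin n) → EuclideanSpace ℝ (Fin n) → EuclideanSpace ℝ (Fin n)}

theorem coord_inducedConnection (hB : IsScalarProduct B) (hPQ : IsCompl P Q)
    (hΓ : IsKoszul (bracket n G) B Γ) {X Y : Field n G} (hX : IsSmooth X) (hY : IsSmooth Y)
    (hYP : ∀ p, coord Y p ∈ P) (p : G) :
    coord (inducedConnection (leftInvariantMetric B) (leftInvariantDistribution P)
        (leftInvariantDistribution Q) X Y) p =
      der X (coord Y) p + projectionAlong P Q (Γ (coord X p) (coord Y p)) := by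
  have hH : hor (leftInvariantDistribution (G := G) P) (leftInvariantDistribution Q) Y = Y := by
    refine coord_injective (funext fun q => ?_)
    rw [coord_hor hPQ, projectionAlong_of_mem_left hPQ (hYP q)]
  have hV : ver (leftInvariantDistribution (G := G) P) (leftInvariantDistribution Q) Y =
      ofCoord fun _ => 0 := by
    refine coord_injective (funext fun q => ?_)
    rw [coord_ofCoord]
    refine (coord_hor hPQ.symm Y q).trans ?_
    rw [projectionAlong_of_mem_right hPQ.symm (hYP q)]
  have hΓ0 : ∀ u, Γ u 0 = 0 := fun u => IsScalarProduct.eq_of_forall hB fun w => by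
    rw [hΓ]; simp
  have hder0 : der X (fun _ => 0) p = 0 := by
    rw [der, mfderiv_const]; rfl
  -- The projection is a constant linear map in these coordinates, so it commutes with
  -- differentiation.
  have hderP : projectionAlong P Q (der X (coord Y) p) = der X (coord Y) p := by
    rw [← der_map X ((contMDiff_coord hY).mdifferentiable (by simp) p)]
    exact congrArg (fun y => der X y p)
      (funext fun q => projectionAlong_of_mem_left hPQ (hYP q))
  unfold inducedConnection
  rw [hH, hV]
  refine (map_add (toModel p) _ _).trans ?_
  have h1 := coord_hor hPQ (leviCivita (leftInvariantMetric B) X Y) p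
  have h2 := coord_hor hPQ.symm (leviCivita (leftInvariantMetric B) X
    (ofCoord (G := G) fun _ => 0)) p
  rw [coord_leviCivita hB hΓ hX hY, map_add, hderP] at h1
  rw [coord_leviCivita hB hΓ hX (isSmooth_const 0), coord_ofCoord, hder0, hΓ0, add_zero,
    map_zero] at h2
  exact (congrArg₂ (· + ·) h1 h2).trans (add_zero _)

/-- The torsion correction cancels exactly the one Koszul term that survives orthogonality, so no
algebraic term remains. -/
theorem coord_connection (hB : IsScalarProduct B) (hPQ : IsCompl P Q)
    (horth : ∀ u ∈ P, ∀ v ∈ Q, B u v = 0) (hbr : ∀ u v, bracket n G u v ∈ Q)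
    {X Y : Field n G} (hX : IsSmooth X) (hY : IsSmooth Y) (p : G) :
    coord (connection (leftInvariantMetric B) (leftInvariantDistribution P)
        (leftInvariantDistribution Q) X Y) p = projectionAlong P Q (der X (coord Y) p) := by
  obtain ⟨Γ, hΓ⟩ := exists_isKoszul (bracket n G) hB
  refine representative_eq hB fun Z hZ => ?_
  have horth' : ∀ v ∈ Q, ∀ u ∈ P, B v u = 0 := fun v hv u hu =>
    (hB.symm v u).trans (horth u hu v hv)
  have hPH : ∀ u ∈ P, ∀ v, B u (projectionAlong P Q v) = B u v := fun u hu v => by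
    conv_rhs => rw [← projectionAlong_add hPQ v, map_add,
      horth u hu _ (projectionAlong_mem hPQ.symm v), add_zero]
  have hPH' : ∀ u ∈ P, ∀ v, B (projectionAlong P Q v) u = B v u := fun u hu v => by
    rw [hB.symm, hPH u hu, hB.symm]
  -- Tested on `P`, each of the three Koszul terms pairs a bracket, which lies in `Q`, with a vector
  -- of `P`.
  have hΓP : ∀ u ∈ P, ∀ v ∈ P, projectionAlong P Q (Γ u v) = 0 := fun u hu v hv =>
    IsScalarProduct.eq_of_forall hB fun w => by
      rw [← hPH _ (projectionAlong_mem hPQ _), hPH' _ (projectionAlong_mem hPQ _), hΓ,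
        horth' _ (hbr _ _) _ (projectionAlong_mem hPQ _), horth' _ (hbr _ _) _ hu,
        horth' _ (hbr _ _) _ hv]
      simp
  have hmem : ∀ (W : Field n G) q, coord (hor (leftInvariantDistribution (G := G) P)
      (leftInvariantDistribution Q) W) q ∈ P := fun W q => by
    rw [coord_hor hPQ]; exact projectionAlong_mem hPQ _
  have hHY := isSmooth_hor hPQ hY
  have hHZ := isSmooth_hor hPQ hZ
  have hT : coord (inducedTorsion (leftInvariantMetric B) (leftInvariantDistribution (G := G) P)
      (leftInvariantDistribution Q)
      (hor (leftInvariantDistribution P) (leftInvariantDistribution Q) Y)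
      (hor (leftInvariantDistribution P) (leftInvariantDistribution Q) Z)) p =
      - bracket n G (projectionAlong P Q (coord Y p)) (projectionAlong P Q (coord Z p)) := by
    unfold inducedTorsion
    have h1 := coord_inducedConnection hB hPQ hΓ hHY hHZ (hmem Z) p
    have h2 := coord_inducedConnection hB hPQ hΓ hHZ hHY (hmem Y) p
    have h3 := coord_mlieBracket hHY hHZ p
    rw [hΓP _ (hmem _ _) _ (hmem _ _), add_zero] at h1 h2
    refine (map_sub (toModel p) _ _).trans ?_
    refine (congrArg₂ (· - ·) ((map_sub (toModel p) _ _).trans (congrArg₂ (· - ·) h1 h2))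
      h3).trans ?_
    rw [coord_hor hPQ, coord_hor hPQ]
    exact sub_add_cancel_left _ _
  have hder : der X (coord (hor (leftInvariantDistribution (G := G) P)
      (leftInvariantDistribution Q) Y)) p = projectionAlong P Q (der X (coord Y) p) := by
    rw [hor_eq hPQ, coord_ofCoord,
      der_map X ((contMDiff_coord hY).mdifferentiable (by simp) p)]
  -- Here `X` need not be horizontal, so the term `-½ B([HY,HZ], X)` of `Γ` persists; the torsion
  -- contributes its negative.
  change _ = B (coord _ p) (coord _ p) - (1 / 2) * B (coord X p) (coord _ p)
  rw [hT, coord_inducedConnection hB hPQ hΓ hX hHY (hmem Y), hder, coord_hor hPQ, coord_hor hPQ,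
    map_add, LinearMap.add_apply, hPH _ (projectionAlong_mem hPQ _),
    hPH' _ (projectionAlong_mem hPQ _), hΓ, horth' _ (hbr _ _) _ (projectionAlong_mem hPQ _),
    horth' _ (hbr _ _) _ (projectionAlong_mem hPQ _), map_neg, hB.symm (coord X p)]
  ring

theorem connection_eq (hB : IsScalarProduct B) (hPQ : IsCompl P Q)
    (horth : ∀ u ∈ P, ∀ v ∈ Q, B u v = 0) (hbr : ∀ u v, bracket n G u v ∈ Q)
    {X Y : Field n G} (hX : IsSmooth X) (hY : IsSmooth Y) :
    connection (leftInvariantMetric B) (leftInvariantDistribution P)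
        (leftInvariantDistribution Q) X Y =
      ofCoord fun p => projectionAlong P Q (der X (coord Y) p) :=
  coord_injective (funext fun p => by
    rw [coord_connection hB hPQ horth hbr hX hY, coord_ofCoord])

/-- The projection commutes with derivatives and is idempotent, so the curvature is the projection
of `XYz - YXz - [X,Y]z`, with `z` the coordinates of `Z`. -/
theorem connectionCurvature_eq_zero (hB : IsScalarProduct B) (hPQ : IsCompl P Q)
    (horth : ∀ u ∈ P, ∀ v ∈ Q, B u v = 0) (hbr : ∀ u v, bracket n G u v ∈ Q)
    {X Y Z : Field n G} (hX : IsSmooth X) (hY : IsSmooth Y) (hZ : IsSmooth Z) (p : G) :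
    connectionCurvature (leftInvariantMetric B) (leftInvariantDistribution P)
        (leftInvariantDistribution Q) X Y Z p = 0 := by
  have hC : ∀ {X Y : Field n G}, IsSmooth X → IsSmooth Y →
      IsSmooth (connection (leftInvariantMetric B) (leftInvariantDistribution P)
        (leftInvariantDistribution Q) X Y) := fun hX hY => by
    rw [connection_eq hB hPQ horth hbr hX hY]
    exact isSmooth_ofCoord (contMDiff_linear_comp _ (contMDiff_der hX (contMDiff_coord hY)))
  have hCC : ∀ {X Y : Field n G}, IsSmooth X → IsSmooth Y →
      coord (connection (leftInvariantMetric B) (leftInvariantDistribution P)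
        (leftInvariantDistribution Q) X (connection (leftInvariantMetric B)
        (leftInvariantDistribution P) (leftInvariantDistribution Q) Y Z)) p =
      projectionAlong P Q (der X (der Y (coord Z)) p) := fun {X Y} hX hY => by
    rw [coord_connection hB hPQ horth hbr hX (hC hY hZ), connection_eq hB hPQ horth hbr hY hZ,
      coord_ofCoord,
      der_map X ((contMDiff_der hY (contMDiff_coord hZ)).mdifferentiable (by simp) p),
      projectionAlong_of_mem_left hPQ (projectionAlong_mem hPQ _)]
  have h3 := coord_connection hB hPQ horth hbr (isSmooth_mlieBracket hX hY) hZ p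
  rw [der_mlieBracket hX hY (contMDiff_coord hZ), map_sub] at h3
  have h : coord (connectionCurvature (leftInvariantMetric B) (leftInvariantDistribution P)
        (leftInvariantDistribution Q) X Y Z) p = 0 := by
    unfold connectionCurvature
    refine (map_sub (toModel p) _ _).trans ?_
    refine (congrArg₂ (· - ·) ((map_sub (toModel p) _ _).trans
      (congrArg₂ (· - ·) (hCC hX hY) (hCC hY hX))) h3).trans ?_
    exact sub_self _
  rw [← ofModel_toModel p (connectionCurvature _ _ _ X Y Z p)]
  exact (congrArg (ofModel p) h).trans (map_zero _)

theorem isSmooth_smoothExtension (p : G) (u : TangentSpace (𝓡 n) p) :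
    IsSmooth (smoothExtension p u) := by
  rw [smoothExtension]
  split_ifs with h
  · exact h.choose_spec.1
  -- The default value, the zero field, is smooth too, so the existence of extensions need not be
  -- settled here.
  · have : IsManifold (𝓡 n) (∞ + 1) G := inferInstanceAs (IsManifold (𝓡 n) ∞ G)
    exact contMDiff_zeroSection ℝ (TangentSpace (𝓡 n) : G → Type _)

theorem hasZeroCurvatures (hB : IsScalarProduct B) (hPQ : IsCompl P Q)
    (horth : ∀ u ∈ P, ∀ v ∈ Q, B u v = 0) (hbr : ∀ u v, bracket n G u v ∈ Q) :
    HasZeroCurvatures (leftInvariantMetric (G := G) B) (leftInvariantDistribution P)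
      (leftInvariantDistribution Q) := by
  have tensor : ∀ X Y Z : Field n G, IsSmooth X → IsSmooth Y → IsSmooth Z → ∀ p,
      curvature (leftInvariantMetric B) (leftInvariantDistribution P)
        (leftInvariantDistribution Q) X Y Z p = 0 := fun X Y Z hX hY hZ p =>
    connectionCurvature_eq_zero hB hPQ horth hbr hX hY (isSmooth_hor hPQ hZ) p
  have hat : ∀ p u v w, curvatureAt (leftInvariantMetric (G := G) B) (leftInvariantDistribution P)
      (leftInvariantDistribution Q) p u v w = 0 := fun p u v w =>
    tensor _ _ _ (isSmooth_smoothExtension p u) (isSmooth_smoothExtension p v)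
      (isSmooth_smoothExtension p w) p
  have ricci : ∀ (p : G) (m : ℕ) (e : Fin m → TangentSpace (𝓡 n) p) w,
      ricciCurvature (leftInvariantMetric B) (leftInvariantDistribution P)
        (leftInvariantDistribution Q) p e w = 0 := fun p m e w => by
    simp [ricciCurvature, hat]
  exact ⟨tensor, fun p u v _ _ _ => by simp [sectionalCurvature, hat],
    fun p m e _ w _ _ => ricci p m e w, fun p m e _ => by simp [scalarCurvature, ricci]⟩

end Curvature

end

/-! ### Dilations, layers and the natural rigging. -/

section

section Rigging

variable {n : ℕ} {G : Type*} [TopologicalSpace G] [ChartedSpace (EuclideanSpace ℝ (Fin n)) G]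
  [Group G] (Δ : Dilations n G)

theorem mem_layer {k : ℕ} {v : GroupLieAlgebra (𝓡 n) G} :
    v ∈ Δ.layer k ↔ ∀ s, Δ.differential s v = (s : ℝ) ^ k • v := by
  simp [Dilations.layer, Submodule.mem_iInf, LinearMap.mem_eqLocus]

/-- `dδ_s` as a linear map on the model space. -/
def diff (s : {s : ℝ // 0 < s}) : EuclideanSpace ℝ (Fin n) →L[ℝ] EuclideanSpace ℝ (Fin n) :=
  mfderiv (𝓡 n) (𝓡 n) (fun q : G => Δ.δ s q) 1

theorem hasMFDerivAt_dilation_one (s : {s : ℝ // 0 < s}) {r : G} (h : r = 1) :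
    HasMFDerivAt (𝓡 n) (𝓡 n) (fun q => Δ.δ s q) r (diff Δ s) := by
  subst h
  exact ((Δ.smooth s).mdifferentiable (by simp) 1).hasMFDerivAt

theorem layer_le_rigging {k : ℕ} (hk : 2 ≤ k) : Δ.layer k ≤ Δ.rigging :=
  le_iSup₂_of_le k hk le_rfl

theorem diff_diff_inv (s : {s : ℝ // 0 < s}) (v : EuclideanSpace ℝ (Fin n)) :
    diff Δ s (diff Δ s⁻¹ v) = v := by
  have h := (hasMFDerivAt_dilation_one Δ s (map_one (Δ.δ s⁻¹))).comp (1 : G)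
    (hasMFDerivAt_dilation_one Δ s⁻¹ rfl)
  have e : (fun q => Δ.δ s q) ∘ (fun q => Δ.δ s⁻¹ q) = id := by
    funext q
    have h1 : Δ.δ s * Δ.δ s⁻¹ = 1 := by rw [← map_mul, mul_inv_cancel, map_one]
    exact congrArg (fun f : MulAut G => f q) h1
  rw [e] at h
  exact congrArg (fun f => f v) (hasMFDerivAt_unique h (hasMFDerivAt_id 1))

/-- A single dilation suffices: the layers lie in eigenspaces of `dδ_2` for the distinct eigenvalues
`2^k`. -/
theorem iSupIndep_layer : iSupIndep Δ.layer := by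
  let s : {s : ℝ // 0 < s} := ⟨2, two_pos⟩
  have h := (Module.End.eigenspaces_iSupIndep (Δ.differential s)).comp
    (f := fun k : ℕ => (2 : ℝ) ^ k) (pow_right_injective₀ two_pos (by norm_num))
  refine h.mono fun k v hv => ?_
  exact Module.End.mem_eigenspace_iff.2 ((mem_layer Δ).1 hv s)

variable [LieGroup (𝓡 n) ∞ G]

/-- Since `δ_s(q) = δ_s(p) δ_s(p⁻¹q)`, the differential at `p` is the one at the identity conjugated
by left translations. -/
theorem hasMFDerivAt_dilation (s : {s : ℝ // 0 < s}) (p : G) :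
    HasMFDerivAt (𝓡 n) (𝓡 n) (fun q => Δ.δ s q) p
      ((ofModel (Δ.δ s p)).comp ((diff Δ s).comp (toModel p)) :
        EuclideanSpace ℝ (Fin n) →L[ℝ] EuclideanSpace ℝ (Fin n)) := by
  have h := (hasMFDerivAt_mul (n := n) (p := Δ.δ s p) (by simp : Δ.δ s (p⁻¹ * p) = 1)).comp p
    ((hasMFDerivAt_dilation_one Δ s (inv_mul_cancel p)).comp p
    (hasMFDerivAt_inv_mul rfl))
  refine h.congr_of_eventuallyEq (Filter.Eventually.of_forall fun q => ?_)
  simp [← map_mul]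

theorem mpullback_ofCoord (s : {s : ℝ // 0 < s}) (v : EuclideanSpace ℝ (Fin n)) :
    mpullback (𝓡 n) (𝓡 n) (fun q => Δ.δ s q) (ofCoord fun _ => diff Δ s v) =
      ofCoord (G := G) fun _ => v := by
  funext p
  have h : (mfderiv (𝓡 n) (𝓡 n) (fun q => Δ.δ s q) p).inverse =
      (ofModel p).comp ((diff Δ s⁻¹).comp (toModel (Δ.δ s p))) := by
    rw [(hasMFDerivAt_dilation Δ s p).mfderiv]
    refine ContinuousLinearMap.inverse_eq ?_ ?_
    · ext1 w
      change ofModel _ (diff Δ s (toModel p (ofModel p (diff Δ s⁻¹ (toModel _ w))))) = w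
      rw [toModel_ofModel, diff_diff_inv, ofModel_toModel]
    · ext1 w
      change ofModel p (diff Δ s⁻¹ (toModel _ (ofModel _ (diff Δ s (toModel p w))))) = w
      have := diff_diff_inv Δ s⁻¹ (toModel p w)
      rw [inv_inv] at this
      rw [toModel_ofModel, this, ofModel_toModel]
  rw [mpullback_apply, h]
  change ofModel p (diff Δ s⁻¹ (toModel _ (ofModel _ (diff Δ s v)))) = ofModel p v
  have := diff_diff_inv Δ s⁻¹ v
  rw [inv_inv] at this
  rw [toModel_ofModel, this]

/-- Pullback by the diffeomorphism `δ_s` respects brackets of vector fields and carries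
left-invariant fields to left-invariant ones. -/
theorem diff_bracket (s : {s : ℝ // 0 < s}) (u v : EuclideanSpace ℝ (Fin n)) :
    diff Δ s (bracket n G u v) = bracket n G (diff Δ s u) (diff Δ s v) := by
  have : IsManifold (𝓡 n) (minSmoothness ℝ 3) G :=
    IsManifold.of_le (n := ∞) ENat.LEInfty.out
  have hs : minSmoothness ℝ 2 ≤ ∞ := by
    rw [minSmoothness_of_isRCLikeNormedField]
    exact ENat.LEInfty.out
  have h := mpullback_mlieBracket (I := 𝓡 n) (I' := 𝓡 n) (n := ∞)
    (IsSmooth.mdifferentiableAt (isSmooth_const (G := G) (diff Δ s u)) (Δ.δ s 1))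
    (IsSmooth.mdifferentiableAt (isSmooth_const (G := G) (diff Δ s v)) (Δ.δ s 1))
    (Δ.smooth s 1) hs
  rw [mpullback_ofCoord, mpullback_ofCoord, mlieBracket_const, mlieBracket_const,
    ← diff_diff_inv Δ s (bracket n G (diff Δ s u) (diff Δ s v)), mpullback_ofCoord] at h
  have h1 := congrArg (toModel (1 : G)) h
  rw [← diff_diff_inv Δ s (bracket n G (diff Δ s u) (diff Δ s v))]
  exact congrArg (diff Δ s) ((toModel_ofModel (1 : G) _).symm.trans (h1.symm.trans
    (toModel_ofModel (1 : G) _)))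

theorem differential_lie (s : {s : ℝ // 0 < s}) (u v : GroupLieAlgebra (𝓡 n) G) :
    Δ.differential s ⁅u, v⁆ = ⁅Δ.differential s u, Δ.differential s v⁆ :=
  diff_bracket Δ s u v

theorem lie_mem_layer {i j : ℕ} {u v : GroupLieAlgebra (𝓡 n) G} (hu : u ∈ Δ.layer i)
    (hv : v ∈ Δ.layer j) : ⁅u, v⁆ ∈ Δ.layer (i + j) := by
  rw [mem_layer] at *
  intro s
  rw [differential_lie, hu, hv, smul_lie, lie_smul, smul_smul, pow_add]

theorem lie_mem_rigging_of_mem {u v : GroupLieAlgebra (𝓡 n) G}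
    (hu : u ∈ Δ.layer 1 ⊔ Δ.rigging) (hv : v ∈ Δ.layer 1 ⊔ Δ.rigging) : ⁅u, v⁆ ∈ Δ.rigging := by
  -- An additive induction principle, applied once in each argument of the bracket, reduces to
  -- homogeneous elements of degrees `i, j ≥ 1`, where `i + j ≥ 2`.
  have key : ∀ P : GroupLieAlgebra (𝓡 n) G → Prop, (∀ k, 1 ≤ k → ∀ u ∈ Δ.layer k, P u) → P 0 →
      (∀ u v, P u → P v → P (u + v)) → ∀ u ∈ Δ.layer 1 ⊔ Δ.rigging, P u := by
    intro P hP h0 hadd u hu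
    obtain ⟨a, ha, b, hb, rfl⟩ := Submodule.mem_sup.1 hu
    refine hadd a b (hP 1 le_rfl a ha) ?_
    rw [Dilations.rigging, iSup_subtype'] at hb
    exact Submodule.iSup_induction _ (motive := P) hb
      (fun k x hx => hP k (one_le_two.trans k.2) x hx) h0 hadd
  refine key (fun u => ⁅u, v⁆ ∈ Δ.rigging) (fun i hi u hu => ?_) ?_ ?_ u hu
  · refine key (fun v => ⁅u, v⁆ ∈ Δ.rigging) (fun j hj v hv => ?_) ?_ ?_ v hv
    · exact layer_le_rigging Δ (by omega) (lie_mem_layer Δ hu hv)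
    · rw [lie_zero]; exact zero_mem _
    · intro a b ha hb; rw [lie_add]; exact add_mem ha hb
  · rw [zero_lie]; exact zero_mem _
  · intro a b ha hb; rw [add_lie]; exact add_mem ha hb

/-- A subspace containing `𝔤_1` and closed under brackets is the whole Lie algebra. -/
theorem eq_top_of_lie_mem (hΔ : Δ.IsCarnot) {S : Submodule ℝ (GroupLieAlgebra (𝓡 n) G)}
    (h1 : Δ.layer 1 ≤ S) (hS : ∀ u ∈ S, ∀ v ∈ S, ⁅u, v⁆ ∈ S) : S = ⊤ := by
  let L : LieSubalgebra ℝ (GroupLieAlgebra (𝓡 n) G) :=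
    { S with lie_mem' := fun hu hv => hS _ hu _ hv }
  have hL : (⊤ : LieSubalgebra ℝ (GroupLieAlgebra (𝓡 n) G)) ≤ L := by
    rw [← hΔ]
    exact LieSubalgebra.lieSpan_le.2 h1
  exact eq_top_iff.2 fun v _ => hL (LieSubalgebra.mem_top v)

theorem isCompl_layer_rigging (hΔ : Δ.IsCarnot) : IsCompl (Δ.layer 1) Δ.rigging := by
  refine ⟨?_, codisjoint_iff.2 ?_⟩
  · refine (iSupIndep_layer Δ 1).mono_right ?_
    exact iSup₂_le fun k hk => le_iSup₂_of_le k (by omega) le_rfl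
  · exact eq_top_of_lie_mem Δ hΔ le_sup_left fun u hu v hv =>
      Submodule.mem_sup_right (lie_mem_rigging_of_mem Δ hu hv)

theorem lie_mem_rigging (hΔ : Δ.IsCarnot) (u v : GroupLieAlgebra (𝓡 n) G) :
    ⁅u, v⁆ ∈ Δ.rigging := by
  have h := (isCompl_layer_rigging Δ hΔ).sup_eq_top
  exact lie_mem_rigging_of_mem Δ (h ▸ Submodule.mem_top) (h ▸ Submodule.mem_top)

/-- The sum of `𝔤_1` and `S ⊓ Δ.rigging` contains all brackets and the generators, so it is
everything; directness of `𝔤_1 ⊕ Δ.rigging` then puts the rigging inside `S`. -/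
theorem rigging_le (hΔ : Δ.IsCarnot) {S : Submodule ℝ (GroupLieAlgebra (𝓡 n) G)}
    (hS : ∀ u v : GroupLieAlgebra (𝓡 n) G, ⁅u, v⁆ ∈ S) : Δ.rigging ≤ S := by
  intro w hw
  have htop : Δ.layer 1 ⊔ (S ⊓ Δ.rigging) = ⊤ := eq_top_of_lie_mem Δ hΔ le_sup_left
    fun u _ v _ => Submodule.mem_sup_right ⟨hS u v, lie_mem_rigging Δ hΔ u v⟩
  obtain ⟨a, ha, b, hb, rfl⟩ := Submodule.mem_sup.1 (htop ▸ Submodule.mem_top : w ∈ _)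
  have ha' : a ∈ Δ.rigging := (Submodule.add_mem_iff_left _ hb.2).1 hw
  rw [Submodule.disjoint_def.1 (isCompl_layer_rigging Δ hΔ).disjoint a ha ha', zero_add]
  exact hb.1

theorem isNaturalRigging (hΔ : Δ.IsCarnot) : IsNaturalRigging (Δ.layer 1) Δ.rigging where
  isCompl := isCompl_layer_rigging Δ hΔ
  formsKillBrackets := fun _ hα W X => hα _ (lie_mem_rigging Δ hΔ W X)
  unique := fun Q' hQ' hF => by
    -- A bracket outside `Q'` would be separated from `Q'` by a linear form, against the condition.
    -- Two nested complements of `𝔤_1` then coincide.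
    have hle : Δ.rigging ≤ Q' := rigging_le Δ hΔ fun u v => by
      by_contra h
      obtain ⟨α, hα, hα'⟩ := Submodule.exists_le_ker_of_notMem h
      exact hα (hF α (fun w hw => hα' hw) u v)
    refine le_antisymm (fun w hw => ?_) hle
    obtain ⟨a, ha, b, hb, rfl⟩ := Submodule.mem_sup.1
      ((isCompl_layer_rigging Δ hΔ).sup_eq_top ▸ Submodule.mem_top : w ∈ _)
    have ha' : a ∈ Q' := (Submodule.add_mem_iff_left _ (hle hb)).1 hw
    rw [Submodule.disjoint_def.1 hQ'.disjoint a ha ha', zero_add]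
    exact hb

end Rigging

/-! ### Adapted scalar products. -/

theorem exists_isScalarProduct (W : Type*) [AddCommGroup W] [Module ℝ W] [FiniteDimensional ℝ W] :
    ∃ B : LinearMap.BilinForm ℝ W, IsScalarProduct B := by
  let e := (Module.finBasis ℝ W).equivFun.trans
    (WithLp.linearEquiv 2 ℝ (Fin (Module.finrank ℝ W) → ℝ)).symm
  refine ⟨(innerₗ (EuclideanSpace ℝ (Fin (Module.finrank ℝ W)))).compl₁₂ e.toLinearMap
    e.toLinearMap, fun u v => real_inner_comm (e v) (e u), fun v hv => ?_⟩
  exact real_inner_self_pos.2 fun h => hv (e.map_eq_zero_iff.1 h)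

/-- The extension is the orthogonal direct sum of `q` with an arbitrary scalar product on `Q`. -/
theorem exists_extension {W : Type*} [AddCommGroup W] [Module ℝ W] [FiniteDimensional ℝ W]
    {P Q : Submodule ℝ W} (h : IsCompl P Q) {q : LinearMap.BilinForm ℝ P}
    (hq : IsScalarProduct q) : ∃ B : LinearMap.BilinForm ℝ W, IsScalarProduct B ∧
      (∀ u v : P, B u v = q u v) ∧ ∀ u ∈ P, ∀ w ∈ Q, B u w = 0 := by
  obtain ⟨b, hb⟩ := exists_isScalarProduct Q
  let pr := P.projectionOnto Q h
  let pr' := Q.projectionOnto P h.symm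
  have hB : ∀ u v, (q.compl₁₂ pr pr + b.compl₁₂ pr' pr') u v =
      q (pr u) (pr v) + b (pr' u) (pr' v) :=
    fun _ _ => rfl
  refine ⟨q.compl₁₂ pr pr + b.compl₁₂ pr' pr', ⟨fun u v => ?_, fun v hv => ?_⟩, fun u v => ?_,
    fun u hu w hw => ?_⟩
  · rw [hB, hB, hq.symm, hb.symm]
  · rw [hB]
    have hq0 : 0 ≤ q (pr v) (pr v) := by
      rcases eq_or_ne (pr v) 0 with h0 | h0
      · simp [h0]
      · exact (hq.pos _ h0).le
    have hb0 : 0 ≤ b (pr' v) (pr' v) := by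
      rcases eq_or_ne (pr' v) 0 with h0 | h0
      · simp [h0]
      · exact (hb.pos _ h0).le
    rcases eq_or_ne (pr v) 0 with h0 | h0
    · have h1 : pr' v ≠ 0 := fun h1 => hv <| Submodule.disjoint_def.1 h.disjoint v
        ((Submodule.projectionOnto_apply_eq_zero_iff h.symm).1 h1)
        ((Submodule.projectionOnto_apply_eq_zero_iff h).1 h0)
      exact add_pos_of_nonneg_of_pos hq0 (hb.pos _ h1)
    · exact add_pos_of_pos_of_nonneg (hq.pos _ h0) hb0
  · rw [hB, Submodule.projectionOnto_apply_left, Submodule.projectionOnto_apply_left,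
      Submodule.projectionOnto_apply_right, map_zero, LinearMap.zero_apply, add_zero]
  · rw [hB, (Submodule.projectionOnto_apply_eq_zero_iff h).2 hw,
      (Submodule.projectionOnto_apply_eq_zero_iff h.symm).2 hu]
    simp

end

end LieGroupFrame

end

theorem mainTheorem5 {n : ℕ} {G : Type*} [TopologicalSpace G]
    [ChartedSpace (EuclideanSpace ℝ (Fin n)) G] [Group G] [LieGroup (𝓡 n) ∞ G]
    (Δ : Dilations n G) (hΔ : Δ.IsCarnot)
    (q : LinearMap.BilinForm ℝ (Δ.layer 1)) (hq : IsScalarProduct q) :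
    IsNaturalRigging (Δ.layer 1) Δ.rigging ∧
    (∃ B : LinearMap.BilinForm ℝ (GroupLieAlgebra (𝓡 n) G), IsAdapted q Δ.rigging B) ∧
    ∀ B : LinearMap.BilinForm ℝ (GroupLieAlgebra (𝓡 n) G), IsAdapted q Δ.rigging B →
      Solovev.HasZeroCurvatures (leftInvariantMetric B)
        (leftInvariantDistribution (Δ.layer 1)) (leftInvariantDistribution Δ.rigging) := by
  have hc := LieGroupFrame.isCompl_layer_rigging Δ hΔ
  have : FiniteDimensional ℝ (GroupLieAlgebra (𝓡 n) G) :=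
    inferInstanceAs (FiniteDimensional ℝ (EuclideanSpace ℝ (Fin n)))
  refine ⟨LieGroupFrame.isNaturalRigging Δ hΔ, ?_, fun B hB => ?_⟩
  · obtain ⟨B, h1, h2, h3⟩ := LieGroupFrame.exists_extension hc hq
    exact ⟨B, h1, h2, h3⟩
  · exact LieGroupFrame.hasZeroCurvatures (n := n) (G := G) (B := B) (P := Δ.layer 1)
      (Q := Δ.rigging) hB.isScalarProduct hc hB.orthogonal (LieGroupFrame.lie_mem_rigging Δ hΔ)
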